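/- Let $A=A_0\oplus A_1\oplus A_2\oplus\cdots$ be an $\mathbb N$-graded (associative, unital, not necessarily commutative) ring such that $A_+=\bigoplus_{i\ge 1}A_i$ is finitely generated as a right ideal. Let $\mathrm{Gr}\,A$ (respectively $\mathrm{Gr}^{\mathbb Z}A$) be the category of $\mathbb N$-graded (respectively $\mathbb Z$-graded) right $A$-modules and degree-preserving $A$-linear maps. A graded module $M$ is called torsion if every homogeneous element of $M$ is annihilated by some power of $A_+$; let $\mathrm{Tors}\,A\subset\mathrm{Gr}\,A$ and $\mathrm{Tors}^{\mathbb Z}A\subset\mathrm{Gr}^{\mathbb Z}A$ be the classes of torsion modules. The quotient category $\mathrm{QGr}\,A=\mathrm{Gr}\,A/\mathrm{Tors}\,A$ is the full subcategory of $\mathrm{Gr}\,A$ of those $M$ with $\mathrm{Hom}(T,M)=0=\mathrm{Ext}^1(T,M)$ for all $T\in\mathrm{Tors}\,A$, and $\mathrm{QGr}^{\mathbb Z}A=\mathrm{Gr}^{\mathbb Z}A/\mathrm{Tors}^{\mathbb Z}A$ is defined in the same way. Then $\mathrm{QGr}\,A$ and $\mathrm{QGr}^{\mathbb Z}A$ are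 Grothendieck categories, and the inclusions $\mathrm{QGr}\,A\hookrightarrow\mathrm{Gr}\,A$ and $\mathrm{QGr}^{\mathbb Z}A\hookrightarrow\mathrm{Gr}^{\mathbb Z}A$ have left adjoints $q:\mathrm{Gr}\,A\to\mathrm{QGr}\,A$ and $Q:\mathrm{Gr}^{\mathbb Z}A\to\mathrm{QGr}^{\mathbb Z}A$ (the quotient functors), which are exact. Let $i:\mathrm{Gr}\,A\to\mathrm{Gr}^{\mathbb Z}A$ be the embedding that regards an $\mathbb N$-graded module as a $\mathbb Z$-graded module vanishing in negative degrees, and let $\tau_{\ge 0}:\mathrm{Gr}^{\mathbb Z}A\to\mathrm{Gr}\,A$, $M\mapsto M_{\ge 0}=\bigoplus_{n\ge 0}M_n$, be the truncation functor. Then for any choice of such left adjoints $q$ and $Q$ the functors $$\iota:\mathrm{QGr}\,A\hookrightarrow\mathrm{Gr}\,A\xrightarrow{\ i\ }\mathrm{Gr}^{\mathbb Z}A\xrightarrow{\ Q\ }\mathrm{QGr}^{\mathbb Z}A,\qquad I:\mathrm{QGr}^{\mathbb Z}A\hookrightarrow\mathrm{Gr}^{\mathbb Z}A\xrightarrow{\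 \tau_{\ge 0}\ }\mathrm{Gr}\,A\xrightarrow{\ q\ }\mathrm{QGr}\,A$$ are mutually inverse equivalences of categories. -/

import Mathlib

open CategoryTheory CategoryTheory.Limits

universe u v w

namespace QuasiCoh

section Ring

variable {A : Type u} [Ring A] (𝒜 : ℕ → AddSubgroup A) [GradedRing 𝒜]

/-- The ideal `A₊ = ⨁_{i ≥ 1} A_i`, regarded as a right ideal of `A`. -/
def irrelevantRight : Submodule Aᵐᵒᵖ A where
  carrier := {a | a ∈ (HomogeneousIdeal.irrelevant 𝒜).toIdeal}
  add_mem' ha hb := (HomogeneousIdeal.irrelevant 𝒜).toIdeal.add_mem ha hb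
  zero_mem' := (HomogeneousIdeal.irrelevant 𝒜).toIdeal.zero_mem
  smul_mem' r a ha := by
    change GradedRing.projZeroRingHom 𝒜 (a * r.unop) = 0
    change GradedRing.projZeroRingHom 𝒜 a = 0 at ha
    rw [map_mul, ha, zero_mul]

end Ring

section GradedModules

variable {A : Type u} [Ring A] (𝒜 : ℕ → AddSubgroup A)

/-- Graded right modules over the graded ring `A = ⨁_{i ∈ ℕ} A_i`, with grading index set `ι`:
right `A`-modules `M` with an (internal) direct sum decomposition `M = ⨁_{j ∈ ι} M_j` as abelian
groups such that `M_j A_i ⊆ M_{j+i}`. It is used for `ι = ℕ` and `ι = ℤ`. -/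
structure GrMod (ι : Type) [DecidableEq ι] [AddMonoidWithOne ι] where
  carrier : Type u
  [addCommGroup : AddCommGroup carrier]
  [module : Module Aᵐᵒᵖ carrier]
  deg : ι → AddSubgroup carrier
  isInternal : DirectSum.IsInternal deg
  smul_mem : ∀ {j : ι} {i : ℕ} {m : carrier} {a : A}, m ∈ deg j → a ∈ 𝒜 i →
    MulOpposite.op a • m ∈ deg (j + (i : ι))

attribute [instance] GrMod.addCommGroup GrMod.module

variable {𝒜} {ι : Type} [DecidableEq ι] [AddMonoidWithOne ι]

/-- The group of morphisms of graded modules: the `A`-linear maps `f` with `f(M_j) ⊆ N_j`. -/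
def GrMod.homs (M N : GrMod 𝒜 ι) : AddSubgroup (M.carrier →ₗ[Aᵐᵒᵖ] N.carrier) where
  carrier := {f | ∀ (j : ι) (m : M.carrier), m ∈ M.deg j → f m ∈ N.deg j}
  add_mem' hf hg j m hm := add_mem (hf j m hm) (hg j m hm)
  zero_mem' j _ _ := zero_mem (N.deg j)
  neg_mem' hf j m hm := neg_mem (hf j m hm)

instance : Category.{u} (GrMod 𝒜 ι) where
  Hom M N := GrMod.homs M N
  id M := ⟨LinearMap.id, fun _ _ hm => hm⟩
  comp f g := ⟨g.1.comp f.1, fun j m hm => g.2 j _ (f.2 j m hm)⟩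

instance : Preadditive (GrMod 𝒜 ι) where
  homGroup M N := inferInstanceAs (AddCommGroup (GrMod.homs M N))
  add_comp _ _ _ f f' g := Subtype.ext (LinearMap.ext fun x => map_add g.1 (f.1 x) (f'.1 x))
  comp_add _ _ _ _ _ _ := rfl

variable (𝒜)

/-- The category `Gr A` of `ℕ`-graded right `A`-modules. -/
abbrev Gr := GrMod 𝒜 ℕ

/-- The category `Gr^ℤ A` of `ℤ`-graded right `A`-modules. -/
abbrev GrZ := GrMod 𝒜 ℤ

end GradedModules

section Internal

variable {ι : Type} [DecidableEq ι] {G : Type u} [AddCommGroup G] (S : ι → AddSubgroup G)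

theorem isInternal_of_iSupIndep (hi : iSupIndep S) (hs : ∀ x : G, x ∈ ⨆ j, S j) :
    DirectSum.IsInternal S := by
  refine ⟨hi.dfinsuppSumAddHom_injective, ?_⟩
  intro x
  have hx := hs x
  induction hx using AddSubgroup.iSup_induction' with
  | hp j x hx => exact ⟨DirectSum.of (fun j => S j) j ⟨x, hx⟩, by simp⟩
  | h1 => exact ⟨0, map_zero _⟩
  | hadd x y _ _ ihx ihy =>
    obtain ⟨a, rfl⟩ := ihx
    obtain ⟨b, rfl⟩ := ihy
    exact ⟨a + b, map_add _ _ _⟩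

theorem iSupIndep_of_isInternal (h : DirectSum.IsInternal S) : iSupIndep S :=
  iSupIndep_of_dfinsuppSumAddHom_injective' S h.1

theorem mem_iSup_of_isInternal (h : DirectSum.IsInternal S) (x : G) : x ∈ ⨆ j, S j := by
  obtain ⟨y, rfl⟩ := h.2 x
  induction y using DirectSum.induction_on with
  | zero => rw [map_zero]; exact zero_mem _
  | of j y =>
    rw [DirectSum.coeAddMonoidHom_of]
    exact AddSubgroup.mem_iSup_of_mem j y.2
  | add a b ha hb => rw [map_add]; exact add_mem ha hb

end Internal

section ExtendTruncate

variable {A : Type u} [Ring A] {𝒜 : ℕ → AddSubgroup A}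

/-- The `ℤ`-grading obtained from an `ℕ`-grading by putting `0` in all negative degrees. -/
def extDeg {G : Type u} [AddCommGroup G] (S : ℕ → AddSubgroup G) : ℤ → AddSubgroup G
  | Int.ofNat n => S n
  | Int.negSucc _ => ⊥

theorem isInternal_extDeg {G : Type u} [AddCommGroup G] (S : ℕ → AddSubgroup G)
    (h : DirectSum.IsInternal S) : DirectSum.IsInternal (extDeg S) := by
  apply isInternal_of_iSupIndep
  · have hS := iSupIndep_of_isInternal S h
    rintro (n | n)
    · refine (hS n).mono_right ?_
      refine iSup₂_le ?_
      rintro (m | m) hm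
      · exact le_iSup₂_of_le m (fun e => hm (by rw [e])) le_rfl
      · exact bot_le
    · exact disjoint_bot_left
  · intro x
    exact (iSup_le fun n => le_iSup (extDeg S) (Int.ofNat n) : (⨆ n, S n) ≤ _)
      (mem_iSup_of_isInternal S h x)

/-- The fully faithful embedding `i : Gr A ⥤ Gr^ℤ A`: an `ℕ`-graded module is a `ℤ`-graded module
that is zero in negative degrees. -/
def extend (𝒜 : ℕ → AddSubgroup A) : Gr 𝒜 ⥤ GrZ 𝒜 where
  obj M :=
    { carrier := M.carrier
      deg := extDeg M.deg
      isInternal := isInternal_extDeg M.deg M.isInternal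
      smul_mem := by
        rintro (n | n) i m a hm ha
        · exact M.smul_mem (j := n) hm ha
        · have hm0 : m = 0 := hm
          rw [hm0, smul_zero]
          exact zero_mem _ }
  map f := ⟨f.1, by
    rintro (n | n) m hm
    · exact f.2 n m hm
    · have hm0 : m = 0 := hm
      rw [hm0, map_zero]
      exact zero_mem _⟩

variable [GradedRing 𝒜]

/-- The tail `M_{≥ 0} = ⨁_{n ≥ 0} M_n` of a `ℤ`-graded module, as an `A`-submodule. -/
def GrMod.tail (M : GrZ 𝒜) : Submodule Aᵐᵒᵖ M.carrier where
  carrier := {m | m ∈ ⨆ n : ℕ, M.deg (n : ℤ)}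
  add_mem' ha hb := (⨆ n : ℕ, M.deg (n : ℤ)).add_mem ha hb
  zero_mem' := (⨆ n : ℕ, M.deg (n : ℤ)).zero_mem
  smul_mem' r m hm := by
    change r • m ∈ ⨆ n : ℕ, M.deg (n : ℤ)
    change m ∈ ⨆ n : ℕ, M.deg (n : ℤ) at hm
    induction hm using AddSubgroup.iSup_induction' with
    | hp n m hm =>
      rw [← MulOpposite.op_unop r]
      induction r.unop using DirectSum.Decomposition.inductionOn 𝒜 with
      | zero => rw [MulOpposite.op_zero, zero_smul]; exact zero_mem _
      | @homogeneous i a =>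
        refine AddSubgroup.mem_iSup_of_mem (n + i) ?_
        have h := M.smul_mem hm a.2
        rwa [← Nat.cast_add] at h
      | add a b ha hb => rw [MulOpposite.op_add, add_smul]; exact add_mem ha hb
    | h1 => rw [smul_zero]; exact zero_mem _
    | hadd x y _ _ ihx ihy => rw [smul_add]; exact add_mem ihx ihy

/-- The `ℕ`-grading of the tail: `(M_{≥ 0})_n = M_n`. -/
def GrMod.tailDeg (M : GrZ 𝒜) (n : ℕ) : AddSubgroup M.tail :=
  (M.deg (n : ℤ)).comap M.tail.subtype.toAddMonoidHom

theorem GrMod.isInternal_tailDeg (M : GrZ 𝒜) : DirectSum.IsInternal M.tailDeg := by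
  have hinj : Function.Injective M.tail.subtype.toAddMonoidHom := Subtype.val_injective
  apply isInternal_of_iSupIndep
  · have hS := iSupIndep_of_isInternal M.deg M.isInternal
    intro n
    rw [AddSubgroup.disjoint_def]
    intro x hx hx'
    refine Subtype.ext ((AddSubgroup.disjoint_def.1 (hS (n : ℤ))) hx ?_)
    have h1 : (⨆ m, ⨆ (_ : m ≠ n), M.tailDeg m) ≤
        (⨆ j, ⨆ (_ : j ≠ (n : ℤ)), M.deg j).comap M.tail.subtype.toAddMonoidHom := by
      refine iSup₂_le fun m hm => AddSubgroup.comap_mono ?_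
      exact le_iSup₂_of_le (m : ℤ) (by exact_mod_cast hm) le_rfl
    exact h1 hx'
  · rintro ⟨x, hx⟩
    change x ∈ ⨆ n : ℕ, M.deg (n : ℤ) at hx
    induction hx using AddSubgroup.iSup_induction' with
    | hp n x hx => exact AddSubgroup.mem_iSup_of_mem n hx
    | h1 => exact zero_mem _
    | hadd x y hx hy ihx ihy => exact add_mem ihx ihy

/-- The truncation functor `τ_{≥ 0} : Gr^ℤ A ⥤ Gr A`, `M ↦ M_{≥ 0}`. -/
def truncate (𝒜 : ℕ → AddSubgroup A) [GradedRing 𝒜] : GrZ 𝒜 ⥤ Gr 𝒜 where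
  obj M :=
    { carrier := M.tail
      deg := M.tailDeg
      isInternal := M.isInternal_tailDeg
      smul_mem := by
        intro n i m a hm ha
        have h := M.smul_mem (j := (n : ℤ)) (m := m.1) hm ha
        change MulOpposite.op a • m.1 ∈ M.deg (((n + i : ℕ) : ℤ))
        rwa [Nat.cast_add] }
  map {M N} f := ⟨f.1.restrict (p := M.tail) (q := N.tail) (by
      intro x hx
      change x ∈ ⨆ n : ℕ, M.deg (n : ℤ) at hx
      change f.1 x ∈ ⨆ n : ℕ, N.deg (n : ℤ)
      induction hx using AddSubgroup.iSup_induction' with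
      | hp n x hx => exact AddSubgroup.mem_iSup_of_mem n (f.2 _ x hx)
      | h1 => rw [map_zero]; exact zero_mem _
      | hadd x y _ _ ihx ihy => rw [map_add]; exact add_mem ihx ihy),
    fun n m hm => f.2 (n : ℤ) m.1 hm⟩

end ExtendTruncate

section Quotient

/-- For a class `T` of objects of an abelian category `C`, the property of being `T`-closed:
`X` is `T`-torsionfree, i.e. `Hom(T, X) = 0`, and `Ext¹(T, X) = 0`, i.e. every short exact sequence
`0 ⟶ X ⟶ E ⟶ Y ⟶ 0` with `Y` in `T` splits. -/
def closedObjects {C : Type v} [Category.{w} C] [Preadditive C] (T : ObjectProperty C) :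
    ObjectProperty C := fun X =>
  (∀ (Y : C), T Y → ∀ f : Y ⟶ X, f = 0) ∧
  (∀ (E Y : C) (f : X ⟶ E) (g : E ⟶ Y) (h : f ≫ g = 0), (ShortComplex.mk f g h).ShortExact →
    T Y → Nonempty (ShortComplex.mk f g h).Splitting)

/-- The quotient category `C/T` of an abelian category by a torsion class: the full subcategory
of `T`-closed objects. -/
abbrev QuotientCategory {C : Type v} [Category.{w} C] [Preadditive C] (T : ObjectProperty C) :=
  (closedObjects T).FullSubcategory

/-- The inclusion functor `C/T ⥤ C`. The localization functor `C ⥤ C/T` is its left adjoint. -/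
abbrev quotientInclusion {C : Type v} [Category.{w} C] [Preadditive C] (T : ObjectProperty C) :
    QuotientCategory T ⥤ C :=
  (closedObjects T).ι

end Quotient

section QGr

variable {A : Type u} [Ring A] (𝒜 : ℕ → AddSubgroup A) [GradedRing 𝒜]

/-- Torsion graded modules: every homogeneous element is annihilated by some power of `A₊`. -/
def torsion (ι : Type) [DecidableEq ι] [AddMonoidWithOne ι] : ObjectProperty (GrMod 𝒜 ι) :=
  fun M => ∀ (j : ι) (m : M.carrier), m ∈ M.deg j →
    ∃ n : ℕ, ∀ a ∈ (HomogeneousIdeal.irrelevant 𝒜).toIdeal ^ n, MulOpposite.op a • m = 0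

/-- `QGr A = Gr A / Tors A`. -/
abbrev QGr := QuotientCategory (torsion 𝒜 ℕ)

/-- `QGr^ℤ A = Gr^ℤ A / Tors^ℤ A`. -/
abbrev QGrZ := QuotientCategory (torsion 𝒜 ℤ)

/-- The inclusion `QGr A ⥤ Gr A`. -/
abbrev inclQGr : QGr 𝒜 ⥤ Gr 𝒜 := quotientInclusion (torsion 𝒜 ℕ)

/-- The inclusion `QGr^ℤ A ⥤ Gr^ℤ A`. -/
abbrev inclQGrZ : QGrZ 𝒜 ⥤ GrZ 𝒜 := quotientInclusion (torsion 𝒜 ℤ)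

end QGr

/-- `C` is a Grothendieck category: it is abelian, has exact filtered colimits and a generator. -/
def IsGrothendieckCategory (C : Type v) [Category.{w} C] : Prop :=
  ∃ _ : Abelian C, IsGrothendieckAbelian.{w} C

end QuasiCoh

/-!
The proof has two halves: localization at torsion, for an arbitrary index monoid of degrees, and the
comparison of the two gradings.

**Localization.** Torsion only depends on the underlying ungraded module. By finite generation of
`A₊` as a right ideal, the operator `sat N = {v | v (A₊)ⁿ ⊆ N for some n}` on submodules is idempotent
(`sat_sat`), a module `M` is torsion exactly when `sat 0 = M`, and idempotency says that torsion
modules are closed under extensions, so that they form a Serre class (`isSerreClass_torsion`).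
Graded modules form a Grothendieck category, because the functor forgetting the grading to
`Aᵐᵒᵖ`-modules is exact, cocontinuous and conservative, and the shifts `A(-j)` separate. In
particular there are enough injectives. Every graded module `M` admits a morphism to a closed
module with torsion kernel and cokernel (`exists_closed`): pass to `M` modulo torsion, embed it into
an injective module, and enlarge it there, by Zorn's lemma, within its saturation while keeping it
torsion-free. Closed objects are local for the morphisms with torsion kernel and cokernel
(`closedObjects_le_isLocal`), so these envelopes give a reflector, every reflector is a localization
functor at these morphisms, and Mathlib's theory of Serre quotients makes it exact and
the quotient abelian. Exactness of filtered colimits and the separator are transported along the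
exact reflector.

**Comparison.** Extension by zero and truncation both preserve the morphisms with torsion kernel and
cokernel. The truncation of the extension of `M` is `M`, and the inclusion `M_{≥ 0} ⊆ M` has torsion
cokernel because `(A₊)ⁿ` lies in degrees `≥ n` (`mem_sat_tail`). After localization, the two functors
are therefore mutually inverse (`qgrEquivalence`).
-/

namespace QuasiCoh

/-! ### Saturation with respect to powers of `A₊` -/

section Saturation

variable {A : Type u} [Ring A] (𝒜 : ℕ → AddSubgroup A) [GradedRing 𝒜]
variable {V W : Type*} [AddCommGroup V] [Module Aᵐᵒᵖ V] [AddCommGroup W] [Module Aᵐᵒᵖ W]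

/-- The ideal `A₊`, as a left ideal. -/
abbrev irr : Ideal A := (HomogeneousIdeal.irrelevant 𝒜).toIdeal

theorem mem_irr_iff {a : A} : a ∈ irr 𝒜 ↔ GradedRing.projZeroRingHom 𝒜 a = 0 := Iff.rfl

theorem irr_mul_mem_right {a : A} (ha : a ∈ irr 𝒜) (r : A) : a * r ∈ irr 𝒜 := by
  rw [mem_irr_iff] at ha ⊢
  rw [map_mul, ha, zero_mul]

theorem one_mem_irr_pow_zero : (1 : A) ∈ irr 𝒜 ^ 0 := Submodule.one_le.mp le_rfl

/-- The left ideal `A₊` is two-sided, so that it can be split off a power on either side. -/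
theorem irr_pow_succ' (n : ℕ) : irr 𝒜 ^ (n + 1) = irr 𝒜 * irr 𝒜 ^ n := by
  rcases n with _ | n
  · rw [Submodule.pow_succ, Submodule.pow_zero, Submodule.one_mul]
    refine le_antisymm (fun a ha => ?_) ?_
    · rw [← mul_one a]
      exact Submodule.mul_mem_mul ha (one_mem_irr_pow_zero 𝒜)
    · exact Submodule.mul_le.2 fun a ha r _ => irr_mul_mem_right 𝒜 ha r
  · exact Submodule.pow_succ' _ n.succ_ne_zero

theorem irr_pow_antitone : Antitone (fun n : ℕ => irr 𝒜 ^ n) :=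
  antitone_nat_of_succ_le fun n => by
    rw [irr_pow_succ']
    exact Submodule.mul_le.2 fun a _ r hr => Ideal.mul_mem_left _ a hr

/-- The saturation of a submodule `N`: the elements `v` with `v (A₊)ⁿ ⊆ N` for some `n`. -/
def sat (N : Submodule Aᵐᵒᵖ V) : Submodule Aᵐᵒᵖ V where
  carrier := {v | ∃ n : ℕ, ∀ a ∈ irr 𝒜 ^ n, MulOpposite.op a • v ∈ N}
  add_mem' := by
    rintro v w ⟨n, hn⟩ ⟨m, hm⟩
    refine ⟨max n m, fun a ha => ?_⟩
    rw [smul_add]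
    exact add_mem (hn a (irr_pow_antitone 𝒜 (le_max_left n m) ha))
      (hm a (irr_pow_antitone 𝒜 (le_max_right n m) ha))
  zero_mem' := ⟨0, fun a _ => by rw [smul_zero]; exact zero_mem _⟩
  smul_mem' := by
    rintro r v ⟨n, hn⟩
    refine ⟨n, fun a ha => ?_⟩
    rw [← MulOpposite.op_unop r, smul_smul, ← MulOpposite.op_mul]
    exact hn _ (Ideal.mul_mem_left _ _ ha)

theorem mem_sat {N : Submodule Aᵐᵒᵖ V} {v : V} :
    v ∈ sat 𝒜 N ↔ ∃ n : ℕ, ∀ a ∈ irr 𝒜 ^ n, MulOpposite.op a • v ∈ N := Iff.rfl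

theorem le_sat (N : Submodule Aᵐᵒᵖ V) : N ≤ sat 𝒜 N :=
  fun _ hv => ⟨0, fun _ _ => N.smul_mem _ hv⟩

theorem sat_mono {N N' : Submodule Aᵐᵒᵖ V} (h : N ≤ N') : sat 𝒜 N ≤ sat 𝒜 N' := by
  rintro v ⟨n, hn⟩
  exact ⟨n, fun a ha => h (hn a ha)⟩

theorem sat_comap (f : V →ₗ[Aᵐᵒᵖ] W) (N : Submodule Aᵐᵒᵖ W) :
    sat 𝒜 (N.comap f) = (sat 𝒜 N).comap f := by
  ext v
  simp [mem_sat]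

variable {𝒜}

/-- An element `v` with `v A₊ ⊆ sat N` lies in `sat N`: only the finitely many elements `v x`,
with `x` in a generating set of the right ideal `A₊`, have to be considered. -/
theorem mem_sat_of_irr_smul_mem (hfg : (irrelevantRight 𝒜).FG) {N : Submodule Aᵐᵒᵖ V} {v : V}
    (hv : ∀ a ∈ irr 𝒜, MulOpposite.op a • v ∈ sat 𝒜 N) : v ∈ sat 𝒜 N := by
  obtain ⟨S, hS⟩ := hfg
  have hSI : ∀ x ∈ S, x ∈ irr 𝒜 := fun x hx => by
    have : x ∈ irrelevantRight 𝒜 := hS ▸ Submodule.subset_span hx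
    exact this
  choose! n hn using fun x (hx : x ∈ S) => hv x (hSI x hx)
  refine ⟨S.sup n + 1, fun a ha => ?_⟩
  rw [irr_pow_succ'] at ha
  induction ha using Submodule.smul_induction_on' with
  | smul b hb c hc =>
    have hb' : b ∈ Submodule.span Aᵐᵒᵖ (S : Set A) := by rw [hS]; exact hb
    simp only [smul_eq_mul]
    -- `b = ∑ x r`, and `v (x r c) = (v x) (r c)` with `r c` in a high power of `A₊`.
    induction hb' using Submodule.span_induction generalizing c with
    | mem x hx =>
      rw [MulOpposite.op_mul, mul_smul]
      exact hn x hx c (irr_pow_antitone 𝒜 (Finset.le_sup hx) hc)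
    | zero => rw [zero_mul, MulOpposite.op_zero, zero_smul]; exact zero_mem _
    | add x y hx hy ihx ihy =>
      rw [add_mul, MulOpposite.op_add, add_smul]
      exact add_mem (ihx (by rw [hS] at hx; exact hx) c hc) (ihy (by rw [hS] at hy; exact hy) c hc)
    | smul r x hx ih =>
      have : r • x * c = x * (r.unop * c) := mul_assoc _ _ _
      rw [this]
      exact ih (by rw [hS] at hx; exact hx) _ (Ideal.mul_mem_left _ _ hc)
  | add x hx y hy ihx ihy =>
    rw [MulOpposite.op_add, add_smul]
    exact add_mem ihx ihy

theorem sat_sat (hfg : (irrelevantRight 𝒜).FG) (N : Submodule Aᵐᵒᵖ V) :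
    sat 𝒜 (sat 𝒜 N) = sat 𝒜 N := by
  refine le_antisymm ?_ (le_sat 𝒜 _)
  rintro v ⟨n, hn⟩
  induction n generalizing v with
  | zero => 
    have h := hn 1 (one_mem_irr_pow_zero 𝒜)
    rwa [MulOpposite.op_one, one_smul] at h
  | succ n ih =>
    refine mem_sat_of_irr_smul_mem hfg fun a ha => ih fun b hb => ?_
    rw [smul_smul, ← MulOpposite.op_mul]
    exact hn _ (by rw [irr_pow_succ']; exact Submodule.mul_mem_mul ha hb)

end Saturation

/-! ### Homogeneous components and homogeneous submodules -/

section Components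

variable {ι : Type} [DecidableEq ι]

/-- A family of subgroups is an internal grading as soon as it generates and there are
homomorphisms `p j` that are injective on the `j`-th subgroup and kill the others. -/
theorem isInternal_of_proj {G : Type u} [AddCommGroup G] {S : ι → AddSubgroup G}
    {H : Type*} [AddCommGroup H] (p : ι → G →+ H)
    (h0 : ∀ j k, j ≠ k → ∀ x ∈ S k, p j x = 0) (h1 : ∀ j, ∀ x ∈ S j, p j x = 0 → x = 0)
    (hs : ∀ x : G, x ∈ ⨆ j, S j) : DirectSum.IsInternal S := by
  refine isInternal_of_iSupIndep S (fun j => ?_) hs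
  rw [AddSubgroup.disjoint_def]
  intro x hx hx'
  have hle : (⨆ k, ⨆ (_ : k ≠ j), S k) ≤ (p j).ker :=
    iSup₂_le fun k hk y hy => h0 j k (Ne.symm hk) y hy
  exact h1 j x hx (hle hx')

variable [AddMonoidWithOne ι] {A : Type u} [Ring A] {𝒜 : ℕ → AddSubgroup A}

namespace GrMod

noncomputable instance (M : GrMod 𝒜 ι) : DirectSum.Decomposition M.deg :=
  M.isInternal.chooseDecomposition

/-- The homogeneous component of degree `j`, as an endomorphism of the additive group. -/
noncomputable def comp (M : GrMod 𝒜 ι) (j : ι) : M.carrier →+ M.carrier :=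
  (M.deg j).subtype.comp
    ((DFinsupp.evalAddMonoidHom j).comp (DirectSum.decomposeAddEquiv M.deg).toAddMonoidHom)

variable (M : GrMod 𝒜 ι)

theorem comp_mem (j : ι) (x : M.carrier) : M.comp j x ∈ M.deg j := SetLike.coe_mem _

theorem comp_of_mem {j : ι} {x : M.carrier} (hx : x ∈ M.deg j) : M.comp j x = x :=
  DirectSum.decompose_of_mem_same _ hx

theorem comp_of_mem_ne {j k : ι} {x : M.carrier} (hx : x ∈ M.deg k) (h : j ≠ k) :
    M.comp j x = 0 :=
  DirectSum.decompose_of_mem_ne _ hx h.symm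

open Classical in
theorem sum_comp (x : M.carrier) :
    ∑ j ∈ (DirectSum.decompose M.deg x).support, M.comp j x = x :=
  DirectSum.sum_support_decompose _ x

@[elab_as_elim]
theorem induction {p : M.carrier → Prop} (x : M.carrier) (zero : p 0)
    (homogeneous : ∀ j, ∀ y ∈ M.deg j, p y) (add : ∀ y z, p y → p z → p (y + z)) : p x :=
  DirectSum.Decomposition.inductionOn M.deg zero (fun {j} y => homogeneous j y y.2)
    add x

/-- A submodule contains an element if it contains its homogeneous components. -/
theorem mem_of_comp_mem {S : Type*} [SetLike S M.carrier] [AddSubmonoidClass S M.carrier]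
    {N : S} {x : M.carrier} (h : ∀ j, M.comp j x ∈ N) : x ∈ N := by
  classical
  rw [← M.sum_comp x]
  exact sum_mem fun j _ => h j

variable {M} in
theorem map_comp {N : GrMod 𝒜 ι} (f : M ⟶ N) (j : ι) (x : M.carrier) :
    f.1 (M.comp j x) = N.comp j (f.1 x) := by
  induction x using M.induction with
  | zero => simp
  | homogeneous k y hy =>
    by_cases h : j = k
    · subst h
      rw [M.comp_of_mem hy, N.comp_of_mem (f.2 _ _ hy)]
    · rw [M.comp_of_mem_ne hy h, N.comp_of_mem_ne (f.2 _ _ hy) h, map_zero]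
  | add y z hy hz => simp only [map_add, hy, hz]

/-- Homogeneous (graded) submodules. -/
def IsHomog (N : Submodule Aᵐᵒᵖ M.carrier) : Prop := ∀ j, ∀ x ∈ N, M.comp j x ∈ N

variable {M}

theorem isHomog_ker {N : GrMod 𝒜 ι} (f : M ⟶ N) : M.IsHomog (LinearMap.ker f.1) := by
  intro j x hx
  rw [LinearMap.mem_ker] at hx ⊢
  rw [map_comp, hx, map_zero]

theorem isHomog_range {N : GrMod 𝒜 ι} (f : M ⟶ N) : N.IsHomog (LinearMap.range f.1) := by
  rintro j _ ⟨x, rfl⟩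
  exact ⟨M.comp j x, map_comp f j x⟩

/-- A homogeneous submodule, as a graded module. -/
def sub (N : Submodule Aᵐᵒᵖ M.carrier) (hN : M.IsHomog N) : GrMod 𝒜 ι where
  carrier := N
  deg j := (M.deg j).comap N.subtype.toAddMonoidHom
  isInternal := by
    refine isInternal_of_proj (fun j => (M.comp j).comp N.subtype.toAddMonoidHom)
      (fun j k hjk x hx => M.comp_of_mem_ne hx hjk)
      (fun j x hx h => Subtype.ext ((M.comp_of_mem hx).symm.trans h)) ?_
    classical
    rintro ⟨x, hx⟩
    have : (⟨x, hx⟩ : N) = ∑ j ∈ (DirectSum.decompose M.deg x).support,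
        (⟨M.comp j x, hN j x hx⟩ : N) :=
      Subtype.ext (by rw [AddSubmonoidClass.coe_finsetSum, M.sum_comp])
    rw [this]
    exact sum_mem fun j _ => AddSubgroup.mem_iSup_of_mem j (M.comp_mem j x)
  smul_mem hm ha := M.smul_mem hm ha

/-- The inclusion of a homogeneous submodule. -/
def subι (N : Submodule Aᵐᵒᵖ M.carrier) (hN : M.IsHomog N) : sub N hN ⟶ M :=
  ⟨N.subtype, fun _ _ hm => hm⟩

/-- The factorization of a morphism through a homogeneous submodule. -/
def subLift {K : GrMod 𝒜 ι} (N : Submodule Aᵐᵒᵖ M.carrier) (hN : M.IsHomog N) (f : K ⟶ M)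
    (hf : ∀ x, f.1 x ∈ N) : K ⟶ sub N hN :=
  ⟨f.1.codRestrict N hf, fun j m hm => f.2 j m hm⟩

/-- The quotient by a homogeneous submodule, as a graded module. -/
def quot (N : Submodule Aᵐᵒᵖ M.carrier) (hN : M.IsHomog N) : GrMod 𝒜 ι where
  carrier := M.carrier ⧸ N
  deg j := (M.deg j).map N.mkQ.toAddMonoidHom
  isInternal := by
    refine isInternal_of_proj (H := M.carrier ⧸ N)
      (fun j => QuotientAddGroup.map N.toAddSubgroup N.toAddSubgroup (M.comp j)
        (fun x hx => hN j x hx)) ?_ ?_ ?_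
    · rintro j k hjk _ ⟨x, hx, rfl⟩
      exact congrArg N.mkQ (M.comp_of_mem_ne hx hjk)
    · rintro j _ ⟨x, hx, rfl⟩ h
      have h' : N.mkQ (M.comp j x) = 0 := h
      rwa [M.comp_of_mem hx] at h'
    · rintro ⟨x⟩
      change N.mkQ x ∈ _
      induction x using M.induction with
      | zero => rw [map_zero]; exact zero_mem _
      | homogeneous j y hy => exact AddSubgroup.mem_iSup_of_mem j ⟨y, hy, rfl⟩
      | add y z hy hz => rw [map_add]; exact add_mem hy hz
  smul_mem := by
    rintro j i _ a ⟨m, hm, rfl⟩ ha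
    exact ⟨MulOpposite.op a • m, M.smul_mem hm ha, map_smul N.mkQ _ _⟩

/-- The projection to a quotient graded module. -/
def quotπ (N : Submodule Aᵐᵒᵖ M.carrier) (hN : M.IsHomog N) : M ⟶ quot N hN :=
  ⟨N.mkQ, fun _ m hm => ⟨m, hm, rfl⟩⟩

/-- The factorization of a morphism through a quotient. -/
def quotDesc {K : GrMod 𝒜 ι} (N : Submodule Aᵐᵒᵖ M.carrier) (hN : M.IsHomog N) (f : M ⟶ K)
    (hf : ∀ x ∈ N, f.1 x = 0) : quot N hN ⟶ K :=
  ⟨N.liftQ f.1 hf, by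
    rintro j _ ⟨m, hm, rfl⟩
    exact f.2 j m hm⟩

/-! ### Monomorphisms, epimorphisms, kernels and cokernels -/

theorem hom_ext {M N : GrMod 𝒜 ι} {f g : M ⟶ N} (h : ∀ x, f.1 x = g.1 x) : f = g :=
  Subtype.ext (LinearMap.ext h)

theorem congr_apply {M N : GrMod 𝒜 ι} {f g : M ⟶ N} (h : f = g) (x : M.carrier) :
    f.1 x = g.1 x := by rw [h]

theorem mono_iff_injective {M N : GrMod 𝒜 ι} (f : M ⟶ N) : Mono f ↔ Function.Injective f.1 := by
  constructor
  · intro hf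
    rw [injective_iff_map_eq_zero]
    intro x hx
    have h : subι _ (isHomog_ker f) = 0 := by
      rw [← cancel_mono f, zero_comp]
      exact hom_ext fun y => y.2
    exact congr_apply h ⟨x, hx⟩
  · exact fun hf => ⟨fun g h e => hom_ext fun x => hf (congr_apply e x)⟩

theorem epi_iff_surjective {M N : GrMod 𝒜 ι} (f : M ⟶ N) : Epi f ↔ Function.Surjective f.1 := by
  constructor
  · intro hf
    have h : quotπ _ (isHomog_range f) = 0 := by
      rw [← cancel_epi f, comp_zero]
      exact hom_ext fun y => (Submodule.Quotient.mk_eq_zero _).2 ⟨y, rfl⟩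
    exact fun y => (Submodule.Quotient.mk_eq_zero _).1 (congr_apply h y)
  · refine fun hf => ⟨fun g h e => hom_ext fun y => ?_⟩
    obtain ⟨x, rfl⟩ := hf y
    exact congr_apply e x

/-- A bijective morphism of graded modules is an isomorphism. -/
theorem isIso_of_bijective {M N : GrMod 𝒜 ι} (f : M ⟶ N) (hf : Function.Bijective f.1) :
    IsIso f := by
  let e := LinearEquiv.ofBijective f.1 hf
  have he : ∀ y, f.1 (e.symm y) = y := e.apply_symm_apply
  refine ⟨⟨e.symm.toLinearMap, fun j y hy => ?_⟩, hom_ext fun x => e.symm_apply_apply x,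
    hom_ext he⟩
  have : e.symm y = M.comp j (e.symm y) := hf.1 (by rw [map_comp, he, N.comp_of_mem hy])
  change e.symm y ∈ _
  rw [this]
  exact M.comp_mem _ _

/-- The submodule `ker f` is the kernel of `f`. -/
def kernelIsLimit {M N : GrMod 𝒜 ι} (f : M ⟶ N) :
    IsLimit (KernelFork.ofι (subι _ (isHomog_ker f)) (f := f) (hom_ext fun x => x.2)) :=
  KernelFork.IsLimit.ofι _ _
    (fun g hg => subLift _ _ g fun x => congr_apply hg x)
    (fun _ _ => rfl)
    (fun _ _ _ hm => hom_ext fun x => Subtype.ext (congr_apply hm x))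

/-- The quotient by the image of `f` is the cokernel of `f`. -/
def cokernelIsColimit {M N : GrMod 𝒜 ι} (f : M ⟶ N) :
    IsColimit (CokernelCofork.ofπ (quotπ _ (isHomog_range f)) (f := f)
      (hom_ext fun x => (Submodule.Quotient.mk_eq_zero _).2 ⟨x, rfl⟩)) :=
  CokernelCofork.IsColimit.ofπ _ _
    (fun g hg => quotDesc _ _ g (by rintro _ ⟨x, rfl⟩; exact congr_apply hg x))
    (fun _ _ => rfl)
    (fun g hg m hm => hom_ext fun x => by
      obtain ⟨y, rfl⟩ := Submodule.mkQ_surjective _ x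
      exact congr_apply hm y)

instance : HasKernels (GrMod 𝒜 ι) := ⟨fun f => ⟨⟨_, kernelIsLimit f⟩⟩⟩

instance : HasCokernels (GrMod 𝒜 ι) := ⟨fun f => ⟨⟨_, cokernelIsColimit f⟩⟩⟩

/-- An injective morphism is the kernel of the projection onto its cokernel. -/
noncomputable abbrev normalMono {M N : GrMod 𝒜 ι} (f : M ⟶ N) (hf : Function.Injective f.1) :
    NormalMono f where
  Z := quot _ (isHomog_range f)
  g := quotπ _ (isHomog_range f)
  w := hom_ext fun x => (Submodule.Quotient.mk_eq_zero _).2 ⟨x, rfl⟩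
  isLimit := by
    have hmem : ∀ x : M.carrier, f.1 x ∈ LinearMap.ker (quotπ _ (isHomog_range f)).1 :=
      fun x => (Submodule.Quotient.mk_eq_zero _).2 ⟨x, rfl⟩
    have hbij : Function.Bijective (subLift _ (isHomog_ker (quotπ _ (isHomog_range f))) f hmem).1 :=
      ⟨fun x y h => hf (congrArg Subtype.val h), fun ⟨y, hy⟩ => by
        obtain ⟨x, rfl⟩ := (Submodule.Quotient.mk_eq_zero _).1 hy
        exact ⟨x, rfl⟩⟩
    have := isIso_of_bijective _ hbij
    exact IsLimit.ofIsoLimit (kernelIsLimit _)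
      (Fork.ext (asIso (subLift _ (isHomog_ker (quotπ _ (isHomog_range f))) f hmem)).symm
        (by rw [Iso.symm_hom, Iso.inv_comp_eq]; rfl))

/-- A surjective morphism is the cokernel of the inclusion of its kernel. -/
noncomputable abbrev normalEpi {M N : GrMod 𝒜 ι} (f : M ⟶ N) (hf : Function.Surjective f.1) :
    NormalEpi f where
  W := sub _ (isHomog_ker f)
  g := subι _ (isHomog_ker f)
  w := hom_ext fun x => x.2
  isColimit := by
    have hmem : ∀ x ∈ LinearMap.range (subι _ (isHomog_ker f)).1, f.1 x = 0 := by
      rintro _ ⟨x, rfl⟩; exact x.2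
    have hbij : Function.Bijective
        (quotDesc _ (isHomog_range (subι _ (isHomog_ker f))) f hmem).1 := by
      refine ⟨(injective_iff_map_eq_zero _).2 fun x hx => ?_, fun y => ?_⟩
      · obtain ⟨x, rfl⟩ := Submodule.mkQ_surjective _ x
        exact (Submodule.Quotient.mk_eq_zero _).2 ⟨⟨x, hx⟩, rfl⟩
      · obtain ⟨x, rfl⟩ := hf y
        exact ⟨Submodule.mkQ _ x, rfl⟩
    have := isIso_of_bijective _ hbij
    exact IsColimit.ofIsoColimit (cokernelIsColimit _)
      (Cofork.ext (asIso (quotDesc _ (isHomog_range (subι _ (isHomog_ker f))) f hmem)) rfl)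

end GrMod

end Components

/-! ### Graded modules form a Grothendieck category -/

section Grothendieck

variable {ι : Type} [DecidableEq ι] [AddMonoidWithOne ι] {A : Type u} [Ring A]
  {𝒜 : ℕ → AddSubgroup A}

namespace GrMod

section Coproduct

open DirectSum Classical

variable {J : Type u} (F : J → GrMod 𝒜 ι)

/-- The direct sum of a family of graded modules. -/
noncomputable def directSum : GrMod 𝒜 ι where
  carrier := ⨁ b, (F b).carrier
  deg j :=
    { carrier := {x | ∀ b, x b ∈ (F b).deg j}
      add_mem' := fun hx hy b => add_mem (hx b) (hy b)
      zero_mem' := fun b => zero_mem _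
      neg_mem' := fun hx b => neg_mem (hx b) }
  isInternal := by
    refine isInternal_of_proj
      (fun j => DFinsupp.mapRange.addMonoidHom fun b => (F b).comp j) ?_ ?_ ?_
    · exact fun j k hjk x hx => DFinsupp.ext fun b => (F b).comp_of_mem_ne (hx b) hjk
    · exact fun j x hx h => DFinsupp.ext fun b =>
        ((F b).comp_of_mem (hx b)).symm.trans (DFinsupp.ext_iff.1 h b)
    · intro x
      induction x using DirectSum.induction_on with
      | zero => exact zero_mem _
      | of b y =>
        induction y using (F b).induction with
        | zero => rw [map_zero]; exact zero_mem _
        | homogeneous j y hy =>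
          refine AddSubgroup.mem_iSup_of_mem j fun c => ?_
          by_cases h : b = c
          · subst h; rwa [DirectSum.of_eq_same]
          · rw [DirectSum.of_eq_of_ne _ _ _ (Ne.symm h)]; exact zero_mem _
        | add y z hy hz => rw [map_add]; exact add_mem hy hz
      | add x y hx hy => exact add_mem hx hy
  smul_mem hm ha b := (F b).smul_mem (hm b) ha

/-- The inclusions into a direct sum. -/
noncomputable def directSumι (b : J) : F b ⟶ directSum F :=
  ⟨DirectSum.lof Aᵐᵒᵖ J (fun b => (F b).carrier) b, fun j m hm c => by
    change DirectSum.of (fun b => (F b).carrier) b m c ∈ (F c).deg j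
    by_cases h : b = c
    · subst h; rwa [DirectSum.of_eq_same]
    · rw [DirectSum.of_eq_of_ne _ _ _ (Ne.symm h)]; exact zero_mem _⟩

/-- The morphism out of a direct sum with given components. -/
noncomputable def directSumDesc {K : GrMod 𝒜 ι} (f : ∀ b, F b ⟶ K) : directSum F ⟶ K :=
  ⟨DirectSum.toModule Aᵐᵒᵖ J K.carrier fun b => (f b).1, fun j (m : ⨁ b, (F b).carrier) hm => by
    have h : DirectSum.toModule Aᵐᵒᵖ J K.carrier (fun b => (f b).1)
        (∑ b ∈ DFinsupp.support m, DirectSum.lof Aᵐᵒᵖ J (fun b => (F b).carrier) b (m b)) ∈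
          K.deg j := by
      rw [map_sum]
      refine sum_mem fun b _ => ?_
      rw [DirectSum.toModule_lof]
      exact (f b).2 j _ (hm b)
    have e : ∑ b ∈ DFinsupp.support m, DirectSum.lof Aᵐᵒᵖ J (fun b => (F b).carrier) b (m b) = m :=
      DirectSum.sum_support_of m
    rwa [e] at h⟩

theorem directSumι_desc {K : GrMod 𝒜 ι} (f : ∀ b, F b ⟶ K) (b : J) :
    directSumι F b ≫ directSumDesc F f = f b :=
  hom_ext fun x => DirectSum.toModule_lof (φ := fun b => (f b).1) Aᵐᵒᵖ b x

theorem directSum_hom_ext {K : GrMod 𝒜 ι} {f g : directSum F ⟶ K}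
    (h : ∀ b, directSumι F b ≫ f = directSumι F b ≫ g) : f = g :=
  Subtype.ext <| DirectSum.linearMap_ext (M := fun b => (F b).carrier) Aᵐᵒᵖ fun b =>
    LinearMap.ext fun x => congr_apply (h b) x

/-- The direct sum is the coproduct. -/
noncomputable def directSumIsColimit : IsColimit (Cofan.mk (directSum F) (directSumι F)) :=
  Cofan.IsColimit.mk _ (fun s => directSumDesc F s.inj)
    (fun s b => directSumι_desc F s.inj b)
    (fun s _ hm => directSum_hom_ext F fun b => (hm b).trans (directSumι_desc F s.inj b).symm)

end Coproduct

instance : HasCoproducts.{u} (GrMod 𝒜 ι) := fun J => ⟨fun K => by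
  have : HasColimit (Discrete.functor (K.obj ∘ Discrete.mk)) := ⟨⟨_, directSumIsColimit _⟩⟩
  exact hasColimit_of_iso (Discrete.natIsoFunctor (F := K))⟩

instance : HasFiniteCoproducts (GrMod 𝒜 ι) := hasFiniteCoproducts_of_hasCoproducts _

instance : HasFiniteBiproducts (GrMod 𝒜 ι) := HasFiniteBiproducts.of_hasFiniteCoproducts

noncomputable instance : Abelian (GrMod 𝒜 ι) where
  normalMonoOfMono f hf := ⟨normalMono f ((mono_iff_injective f).1 hf)⟩
  normalEpiOfEpi f hf := ⟨normalEpi f ((epi_iff_surjective f).1 hf)⟩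
  has_finite_products := inferInstance
  has_kernels := inferInstance
  has_cokernels := inferInstance

instance : HasColimitsOfSize.{u, u} (GrMod 𝒜 ι) := has_colimits_of_hasCoequalizers_and_coproducts

variable (ι 𝒜) in
/-- The functor that forgets the grading. It is exact, conservative and cocontinuous, so that
exactness of filtered colimits is inherited from modules. -/
def forgetGrading : GrMod 𝒜 ι ⥤ ModuleCat.{u} Aᵐᵒᵖ where
  obj M := ModuleCat.of _ M.carrier
  map f := ModuleCat.ofHom f.1

instance : (forgetGrading ι 𝒜).Faithful where
  map_injective h := hom_ext fun x => ConcreteCategory.congr_hom h x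

instance : (forgetGrading ι 𝒜).Additive where
  map_add := rfl

instance : (forgetGrading ι 𝒜).ReflectsIsomorphisms where
  reflects f _ :=
    isIso_of_bijective f (ConcreteCategory.bijective_of_isIso ((forgetGrading ι 𝒜).map f))

instance : (forgetGrading ι 𝒜).PreservesMonomorphisms where
  preserves f hf := (ModuleCat.mono_iff_injective _).2 ((mono_iff_injective f).1 hf)

instance {M N : GrMod 𝒜 ι} (f : M ⟶ N) :
    PreservesColimit (parallelPair f 0) (forgetGrading ι 𝒜) := by
  refine preservesColimit_of_preserves_colimit_cocone (cokernelIsColimit f) ?_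
  refine (CokernelCofork.isColimitMapCoconeEquiv _ _).2 ?_
  have h0 : (forgetGrading ι 𝒜).map f ≫ (forgetGrading ι 𝒜).map (quotπ _ (isHomog_range f)) = 0 :=
    ModuleCat.hom_ext <| LinearMap.ext fun x => (Submodule.Quotient.mk_eq_zero _).2 ⟨x, rfl⟩
  exact CokernelCofork.IsColimit.ofπ _ h0
    (fun g hg => ModuleCat.ofHom <| (LinearMap.range f.1).liftQ g.hom (by
      rintro _ ⟨x, rfl⟩
      exact ConcreteCategory.congr_hom hg x))
    (fun _ _ => rfl)
    (fun _ _ _ hm => ModuleCat.hom_ext <| LinearMap.ext fun x => by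
      obtain ⟨y, rfl⟩ := Submodule.mkQ_surjective _ x
      exact ConcreteCategory.congr_hom hm y)

instance : (forgetGrading ι 𝒜).PreservesHomology :=
  Functor.preservesHomology_of_preservesMonos_and_cokernels _

theorem function_exact {S : ShortComplex (GrMod 𝒜 ι)} (hS : S.Exact) :
    Function.Exact S.f.1 S.g.1 :=
  (ShortComplex.ShortExact.moduleCat_exact_iff_function_exact
    (S.map (forgetGrading ι 𝒜))).1 (hS.map _)

instance : PreservesFiniteLimits (forgetGrading ι 𝒜) :=
  Functor.preservesFiniteLimits_of_preservesHomology _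

instance : PreservesFiniteColimits (forgetGrading ι 𝒜) :=
  Functor.preservesFiniteColimits_of_preservesHomology _

instance (J : Type u) : PreservesColimitsOfShape (Discrete J) (forgetGrading ι 𝒜) where
  preservesColimit {K} := by
    classical
    have : PreservesColimit (Discrete.functor (K.obj ∘ Discrete.mk)) (forgetGrading ι 𝒜) := by
      refine preservesColimit_of_preserves_colimit_cocone (directSumIsColimit _) ?_
      refine (isColimitMapCoconeCofanMkEquiv _ _ _).2 ?_
      exact ModuleCat.coproductCoconeIsColimit
        (fun b : J => (forgetGrading ι 𝒜).obj (K.obj ⟨b⟩))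
    exact preservesColimit_of_iso_diagram _ (Discrete.natIsoFunctor (F := K)).symm

instance : PreservesColimitsOfSize.{u, u} (forgetGrading ι 𝒜) :=
  preservesColimits_of_preservesCoequalizers_and_coproducts _

instance : AB5OfSize.{u, u} (GrMod 𝒜 ι) where
  ofShape J _ _ := HasExactColimitsOfShape.domain_of_functor J (forgetGrading ι 𝒜)

section Separator

variable [GradedRing 𝒜]

variable (𝒜) in
/-- The free graded module `A(-j)` with one generator in degree `j`. As addition on `ι` is not
assumed to be cancellative, several `𝒜 i` may contribute to one degree. -/
def free (j : ι) : GrMod 𝒜 ι where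
  carrier := A
  deg k := ⨆ (i : ℕ) (_ : j + (i : ι) = k), 𝒜 i
  isInternal := by
    refine isInternal_of_proj (H := ℕ → A)
      (fun k => AddMonoidHom.mk' (fun a i => if j + (i : ι) = k then GradedRing.proj 𝒜 i a else 0)
        (fun a b => by ext i; by_cases h : j + (i : ι) = k <;> simp [h])) ?_ ?_ ?_
    · intro k l hkl x hx
      ext i
      by_cases h : j + (i : ι) = k
      · have hle : (⨆ (i : ℕ) (_ : j + (i : ι) = l), 𝒜 i) ≤ (GradedRing.proj 𝒜 i).ker := by
          refine iSup₂_le fun m hm y hy => ?_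
          refine DirectSum.decompose_of_mem_ne 𝒜 hy ?_
          rintro rfl
          exact hkl (h.symm.trans hm)
        simpa [h] using hle hx
      · simp [h]
    · intro k x hx h
      classical
      rw [← DirectSum.sum_support_decompose 𝒜 x]
      refine Finset.sum_eq_zero fun i _ => ?_
      by_cases hi : j + (i : ι) = k
      · simpa [hi] using congrFun h i
      · have hle : (⨆ (i : ℕ) (_ : j + (i : ι) = k), 𝒜 i) ≤ (GradedRing.proj 𝒜 i).ker := by
          refine iSup₂_le fun m hm y hy => ?_
          refine DirectSum.decompose_of_mem_ne 𝒜 hy ?_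
          rintro rfl
          exact hi hm
        exact hle hx
    · intro x
      induction x using DirectSum.Decomposition.inductionOn 𝒜 with
      | zero => exact zero_mem _
      | @homogeneous i a =>
        exact AddSubgroup.mem_iSup_of_mem (j + (i : ι))
          (AddSubgroup.mem_iSup_of_mem i (AddSubgroup.mem_iSup_of_mem rfl a.2))
      | add a b ha hb => exact add_mem ha hb
  smul_mem := by
    intro k i m a hm ha
    change m * a ∈ _
    have hle : (⨆ (l : ℕ) (_ : j + (l : ι) = k), 𝒜 l) ≤
        (⨆ (l : ℕ) (_ : j + (l : ι) = k + (i : ι)), 𝒜 l).comap (AddMonoidHom.mulRight a) := by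
      refine iSup₂_le fun l hl y hy => ?_
      refine AddSubgroup.mem_iSup_of_mem (l + i) (AddSubgroup.mem_iSup_of_mem ?_
        (SetLike.mul_mem_graded hy ha))
      rw [Nat.cast_add, ← add_assoc, hl]
    exact hle hm

/-- The morphism `A(-j) ⟶ M` that sends the generator to a given element of degree `j`. -/
def freeDesc {M : GrMod 𝒜 ι} {j : ι} (m : M.carrier) (hm : m ∈ M.deg j) : free 𝒜 j ⟶ M :=
  ⟨{ toFun := fun a : A => MulOpposite.op a • m
     map_add' := fun a b => by rw [← add_smul]; rfl
     map_smul' := fun r (a : A) => by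
      change MulOpposite.op (a * r.unop) • m = r • MulOpposite.op a • m
      rw [smul_smul]; rfl }, by
    intro k x hx
    have hle : (⨆ (l : ℕ) (_ : j + (l : ι) = k), 𝒜 l) ≤
        (M.deg k).comap (AddMonoidHom.mk' (fun a : A => MulOpposite.op a • m)
          (fun a b => by rw [← add_smul]; rfl)) := by
      refine iSup₂_le fun l hl y hy => ?_
      subst hl
      exact M.smul_mem hm hy
    exact hle hx⟩

instance : HasSeparator (GrMod 𝒜 ι) := by
  have hsep : ObjectProperty.IsSeparating
      (.ofObj fun j : ULift.{u} ι => free 𝒜 j.down) := by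
    intro M N f g h
    refine hom_ext fun x => ?_
    induction x using M.induction with
    | zero => rw [map_zero, map_zero]
    | homogeneous j y hy =>
      have e := congr_apply (h _ (ObjectProperty.ofObj_apply _ ⟨j⟩) (freeDesc y hy)) (1 : A)
      have h1 : (freeDesc (𝒜 := 𝒜) y hy).1 (1 : A) = y := one_smul Aᵐᵒᵖ y
      change f.1 ((freeDesc (𝒜 := 𝒜) y hy).1 (1 : A)) =
        g.1 ((freeDesc (𝒜 := 𝒜) y hy).1 (1 : A)) at e
      rwa [h1] at e
    | add y z hy hz => rw [map_add, map_add, hy, hz]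
  exact ⟨⟨_, hsep.isSeparator_coproduct⟩⟩

instance : IsGrothendieckAbelian.{u} (GrMod 𝒜 ι) where

end Separator

end GrMod

end Grothendieck

/-! ### Closed objects for a Serre class -/

section Serre

variable {C : Type v} [Category.{w} C] [Abelian C] (P : ObjectProperty C) [P.IsSerreClass]

/-- Closed objects are local with respect to the morphisms with kernel and cokernel in `P`. To
extend `f : X ⟶ Z` along such an `s : X ⟶ Y`, the pushout of `s` along `f` is split. -/
theorem closedObjects_le_isLocal : closedObjects P ≤ P.isoModSerre.isLocal := by
  rintro Z ⟨hhom, hext⟩ X Y s hs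
  refine ⟨fun g g' h => ?_, fun f => ?_⟩
  · have h0 : s ≫ (g - g') = 0 := by rw [Preadditive.comp_sub]; exact sub_eq_zero.2 h
    rw [← sub_eq_zero, ← cokernel.π_desc s _ h0, hhom _ hs.2 (cokernel.desc s _ h0), comp_zero]
  · have hinr : P.isoModSerre (pushout.inr s f) := MorphismProperty.pushout_inr _ _ hs
    have hmono : Mono (pushout.inr s f) :=
      Preadditive.mono_of_kernel_zero (hhom _ hinr.1 _)
    obtain ⟨σ⟩ := hext _ _ (pushout.inr s f) (cokernel.π _) (cokernel.condition _)
      { exact := ShortComplex.exact_cokernel _ } hinr.2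
    refine ⟨pushout.inl s f ≫ σ.r, ?_⟩
    change s ≫ pushout.inl s f ≫ σ.r = f
    have := σ.f_r
    dsimp at this
    rw [pushout.condition_assoc, this, Category.comp_id]

variable {P}

/-- If every object maps to a closed object by an isomorphism modulo `P`, then closed objects
form a reflective subcategory. -/
theorem isRightAdjoint_quotientInclusion
    (h : ∀ X : C, ∃ (Z : C) (η : X ⟶ Z), closedObjects P Z ∧ P.isoModSerre η) :
    (quotientInclusion P).IsRightAdjoint := by
  have : ∀ X, HasInitial (StructuredArrow X (quotientInclusion P)) := by
    intro X
    obtain ⟨Z, η, hZ, hη⟩ := h X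
    -- `η` is initial among the morphisms from `X` to closed objects.
    have hloc : ∀ B : QuotientCategory P, Function.Bijective fun g : Z ⟶ B.obj => η ≫ g :=
      fun B => closedObjects_le_isLocal P _ B.property η hη
    refine IsInitial.hasInitial
      (X := StructuredArrow.mk (Y := (⟨Z, hZ⟩ : QuotientCategory P)) η)
      (IsInitial.ofUniqueHom (fun Y => StructuredArrow.homMk
        (ObjectProperty.homMk ((hloc Y.right).2 Y.hom).choose) ((hloc Y.right).2 Y.hom).choose_spec)
        fun Y m => ?_)
    ext
    refine (hloc Y.right).1 ?_
    exact (StructuredArrow.w m).trans ((hloc Y.right).2 Y.hom).choose_spec.symm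
  exact isRightAdjointOfStructuredArrowInitials _

section Adjunction

variable {q : C ⥤ QuotientCategory P} (adj : q ⊣ quotientInclusion P)

include adj

/-- A reflector inverts the isomorphisms modulo `P`, as closed objects are local for them. -/
theorem isoModSerre_isInvertedBy : P.isoModSerre.IsInvertedBy q := by
  intro X Y f hf
  rw [← ObjectProperty.isLocal_iff_isIso_map adj]
  rintro _ ⟨Z, rfl⟩
  exact closedObjects_le_isLocal P _ Z.property f hf

/-- The unit of a reflector agrees with the given morphisms to closed objects up to isomorphism. -/
theorem isoModSerre_unit
    (h : ∀ X : C, ∃ (Z : C) (η : X ⟶ Z), closedObjects P Z ∧ P.isoModSerre η) (X : C) :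
    P.isoModSerre (adj.unit.app X) := by
  obtain ⟨Z, η, hZ, hη⟩ := h X
  have : IsIso (q.map η) := isoModSerre_isInvertedBy adj η hη
  have : IsIso (adj.unit.app Z) := adj.isIso_unit_app_of_iso (X := ⟨Z, hZ⟩) (Iso.refl _)
  have e := adj.unit.naturality η
  have e' : adj.unit.app X = η ≫ adj.unit.app Z ≫ inv ((quotientInclusion P).map (q.map η)) := by
    rw [← Category.assoc, IsIso.eq_comp_inv]
    exact e.symm
  rw [e']
  exact P.isoModSerre.comp_mem _ _ hη (P.isoModSerre_of_isIso _)

variable (h : ∀ X : C, ∃ (Z : C) (η : X ⟶ Z), closedObjects P Z ∧ P.isoModSerre η)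

include h

theorem isLocalization_isoModSerre : q.IsLocalization P.isoModSerre :=
  adj.isLocalization_leftAdjoint _ (isoModSerre_isInvertedBy adj) (isoModSerre_unit adj h)

theorem preservesFiniteLimits_and_colimits :
    PreservesFiniteLimits q ∧ PreservesFiniteColimits q := by
  have := isLocalization_isoModSerre adj h
  have := adj.left_adjoint_additive
  exact ⟨ObjectProperty.SerreClassLocalization.preservesFiniteLimits q P,
    ObjectProperty.SerreClassLocalization.preservesFiniteColimits q P⟩

/-- The quotient of a Grothendieck category by a Serre class whose closed objects are reflective as
above is a Grothendieck category: `q` is an exact reflector, and it maps a separator to a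
separator. -/
theorem isGrothendieckCategory_quotient [IsGrothendieckAbelian.{w} C] :
    IsGrothendieckCategory (QuotientCategory P) := by
  have := isLocalization_isoModSerre adj h
  have := adj.left_adjoint_additive
  let _ : Abelian (QuotientCategory P) :=
    ObjectProperty.SerreClassLocalization.abelian q P
  have := (preservesFiniteLimits_and_colimits adj h).1
  have hcolim : ∀ (J : Type w) [Category.{w} J], HasColimitsOfShape J (QuotientCategory P) :=
    fun J _ => by
      let _ : Reflective (quotientInclusion P) := { L := q, adj := adj }
      exact hasColimitsOfShape_of_reflective (quotientInclusion P)
  have : HasFilteredColimitsOfSize.{w, w} (QuotientCategory P) := ⟨fun J _ _ => hcolim J⟩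
  have : AB5OfSize.{w, w} (QuotientCategory P) :=
    ⟨fun J _ _ => adj.hasExactColimitsOfShape J⟩
  have : HasSeparator (QuotientCategory P) := by
    refine ⟨q.obj (separator C), (isSeparator_def _).2 fun X Y f g hfg => ?_⟩
    apply (quotientInclusion P).map_injective
    refine (isSeparator_separator C).def _ _ fun k => ?_
    have := hfg ((adj.homEquiv _ _).symm k)
    rw [← Adjunction.homEquiv_naturality_right_symm, ← Adjunction.homEquiv_naturality_right_symm]
      at this
    exact (adj.homEquiv _ _).symm.injective this
  exact ⟨inferInstance, {}⟩

end Adjunction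

end Serre

/-! ### Torsion modules form a Serre class -/

section Torsion

variable {ι : Type} [DecidableEq ι] [AddMonoidWithOne ι] {A : Type u} [Ring A]
  {𝒜 : ℕ → AddSubgroup A} [GradedRing 𝒜]

/-- In a torsion module, inhomogeneous elements are annihilated by powers of `A₊` as well. -/
theorem torsion_iff (M : GrMod 𝒜 ι) :
    torsion 𝒜 ι M ↔ ∀ m : M.carrier, m ∈ sat 𝒜 (⊥ : Submodule Aᵐᵒᵖ M.carrier) := by
  refine ⟨fun h m => ?_, fun h j m _ => h m⟩
  induction m using M.induction with
  | zero => exact zero_mem _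
  | homogeneous j y hy => exact h j y hy
  | add y z hy hz => exact add_mem hy hz

section Modules

variable {V W : Type*} [AddCommGroup V] [Module Aᵐᵒᵖ V] [AddCommGroup W] [Module Aᵐᵒᵖ W]

theorem map_mem_sat_bot (f : V →ₗ[Aᵐᵒᵖ] W) {v : V} (hv : v ∈ sat 𝒜 ⊥) : f v ∈ sat 𝒜 ⊥ := by
  change v ∈ (sat 𝒜 ⊥).comap f
  rw [← sat_comap]
  exact sat_mono 𝒜 bot_le hv

theorem mem_sat_ker_iff (f : V →ₗ[Aᵐᵒᵖ] W) {v : V} :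
    v ∈ sat 𝒜 (LinearMap.ker f) ↔ f v ∈ sat 𝒜 ⊥ := by
  rw [LinearMap.ker, sat_comap]
  rfl

theorem map_mem_sat_bot_iff {f : V →ₗ[Aᵐᵒᵖ] W} (hf : Function.Injective f) {v : V} :
    f v ∈ sat 𝒜 ⊥ ↔ v ∈ sat 𝒜 ⊥ := by
  rw [← mem_sat_ker_iff, LinearMap.ker_eq_bot.2 hf]

end Modules

open ZeroObject in
/-- Finite generation of `A₊` enters in the closure under extensions. -/
theorem isSerreClass_torsion (hfg : (irrelevantRight 𝒜).FG) : (torsion 𝒜 ι).IsSerreClass where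
  exists_zero := by
    refine ⟨0, isZero_zero _, (torsion_iff _).2 fun m => ?_⟩
    have h : 𝟙 (0 : GrMod 𝒜 ι) = 0 := (isZero_zero _).eq_of_src _ _
    have h' : m = 0 := GrMod.congr_apply h m
    rw [h']
    exact zero_mem _
  prop_of_mono {M N} f hf hN := by
    rw [torsion_iff] at hN ⊢
    exact fun m => (map_mem_sat_bot_iff ((GrMod.mono_iff_injective f).1 hf)).1 (hN _)
  prop_of_epi {M N} f hf hM := by
    rw [torsion_iff] at hM ⊢
    intro m
    obtain ⟨x, rfl⟩ := (GrMod.epi_iff_surjective f).1 hf m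
    exact map_mem_sat_bot _ (hM x)
  prop_X₂_of_shortExact {S} hS h₁ h₃ := by
    rw [torsion_iff] at h₁ h₃ ⊢
    intro m
    rw [← sat_sat hfg]
    refine sat_mono 𝒜 ?_ ((mem_sat_ker_iff S.g.1).2 (h₃ (S.g.1 m)))
    intro x hx
    obtain ⟨y, rfl⟩ := (GrMod.function_exact hS.exact x).1 hx
    exact map_mem_sat_bot _ (h₁ y)

/-- Isomorphisms modulo torsion, in terms of elements. -/
theorem isoModSerre_torsion_iff [(torsion 𝒜 ι).IsSerreClass] {M N : GrMod 𝒜 ι} (f : M ⟶ N) :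
    (torsion 𝒜 ι).isoModSerre f ↔
      (∀ x, f.1 x = 0 → x ∈ sat 𝒜 ⊥) ∧ ∀ y, y ∈ sat 𝒜 (LinearMap.range f.1) := by
  have e₁ : kernel f ≅ GrMod.sub _ (GrMod.isHomog_ker f) :=
    (kernelIsKernel f).conePointUniqueUpToIso (GrMod.kernelIsLimit f)
  have e₂ : cokernel f ≅ GrMod.quot _ (GrMod.isHomog_range f) :=
    (cokernelIsCokernel f).coconePointUniqueUpToIso (GrMod.cokernelIsColimit f)
  refine and_congr (((torsion 𝒜 ι).prop_iff_of_iso e₁).trans ?_)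
    (((torsion 𝒜 ι).prop_iff_of_iso e₂).trans ?_)
  · rw [torsion_iff]
    exact ⟨fun h x hx => map_mem_sat_bot (LinearMap.ker f.1).subtype (h ⟨x, hx⟩), fun h x =>
      (map_mem_sat_bot_iff (LinearMap.ker f.1).injective_subtype).1 (h x.1 x.2)⟩
  · rw [torsion_iff]
    have h : ∀ y : N.carrier, y ∈ sat 𝒜 (LinearMap.range f.1) ↔
        (LinearMap.range f.1).mkQ y ∈ sat 𝒜 ⊥ := fun y => by
      rw [← mem_sat_ker_iff, Submodule.ker_mkQ]
    exact ⟨fun hq y => (h y).2 (hq _), fun hN y => by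
      obtain ⟨y, rfl⟩ := Submodule.mkQ_surjective _ y
      exact (h y).1 (hN y)⟩

/-! ### The closed envelope of a graded module -/

namespace GrMod

variable (M : GrMod 𝒜 ι)

/-- The largest homogeneous submodule contained in a submodule. -/
def homogCore (N : Submodule Aᵐᵒᵖ M.carrier) : Submodule Aᵐᵒᵖ M.carrier where
  carrier := {x | ∀ j, M.comp j x ∈ N}
  add_mem' hx hy j := by rw [map_add]; exact add_mem (hx j) (hy j)
  zero_mem' j := by rw [map_zero]; exact zero_mem _
  smul_mem' r x hx j := by
    classical
    rw [← MulOpposite.op_unop r]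
    induction r.unop using DirectSum.Decomposition.inductionOn 𝒜 with
    | zero => rw [MulOpposite.op_zero, zero_smul, map_zero]; exact zero_mem _
    | @homogeneous i a =>
      rw [← M.sum_comp x, Finset.smul_sum, map_sum]
      refine sum_mem fun k _ => ?_
      have hk := M.smul_mem (M.comp_mem k x) a.2
      by_cases h : j = k + (i : ι)
      · rw [h, M.comp_of_mem hk]
        exact N.smul_mem _ (hx k)
      · rw [M.comp_of_mem_ne hk h]
        exact zero_mem _
    | add a b ha hb => rw [MulOpposite.op_add, add_smul, map_add]; exact add_mem ha hb

theorem isHomog_homogCore (N : Submodule Aᵐᵒᵖ M.carrier) : M.IsHomog (M.homogCore N) := by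
  intro j x hx k
  by_cases h : k = j
  · rw [h, M.comp_of_mem (M.comp_mem j x)]
    exact hx j
  · rw [M.comp_of_mem_ne (M.comp_mem j x) h]
    exact zero_mem _

theorem homogCore_le (N : Submodule Aᵐᵒᵖ M.carrier) : M.homogCore N ≤ N :=
  fun _ hx => M.mem_of_comp_mem hx

/-- The torsion submodule of a graded module: the elements whose homogeneous components are
annihilated by powers of `A₊`. -/
abbrev torsionPart : Submodule Aᵐᵒᵖ M.carrier := M.homogCore (sat 𝒜 ⊥)

variable {M}

theorem map_mem_torsionPart {N : GrMod 𝒜 ι} (f : M ⟶ N) {x : M.carrier}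
    (hx : x ∈ M.torsionPart) : f.1 x ∈ N.torsionPart := fun j => by
  rw [← map_comp]
  exact map_mem_sat_bot _ (hx j)

theorem torsionPart_eq_top (hM : torsion 𝒜 ι M) (x : M.carrier) : x ∈ M.torsionPart :=
  fun _ => (torsion_iff M).1 hM _

theorem mem_torsionPart_of_map {N : GrMod 𝒜 ι} (f : M ⟶ N) (hf : Function.Injective f.1)
    {x : M.carrier} (hx : f.1 x ∈ N.torsionPart) : x ∈ M.torsionPart := fun j => by
  have h := hx j
  rw [← map_comp] at h
  exact (map_mem_sat_bot_iff hf).1 h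

variable (hfg : (irrelevantRight 𝒜).FG)
include hfg

theorem torsionPart_quot_torsionPart (M : GrMod 𝒜 ι) :
    (quot _ (M.isHomog_homogCore (sat 𝒜 ⊥))).torsionPart = ⊥ := by
  rw [eq_bot_iff]
  intro y hy
  obtain ⟨x, rfl⟩ := Submodule.mkQ_surjective _ y
  refine (Submodule.Quotient.mk_eq_zero _).2 fun j => ?_
  have h := hy j
  change comp _ j ((quotπ _ (M.isHomog_homogCore (sat 𝒜 ⊥))).1 x) ∈ _ at h
  rw [← map_comp, ← mem_sat_ker_iff] at h
  rw [← sat_sat hfg]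
  refine sat_mono 𝒜 ?_ h
  change LinearMap.ker (Submodule.mkQ _) ≤ _
  rw [Submodule.ker_mkQ]
  exact M.homogCore_le _

/-- Every torsion-free graded module `M` embeds into a closed one with torsion cokernel.
Inside an injective module `E` containing `M`, let `N` be maximal among the homogeneous submodules
that contain `M`, are torsion over `M` and meet the torsion of `E` trivially. If `X ⊇ N` has
torsion cokernel, then `N → E` extends to `X` modulo its torsion, and the image of this extension
still has the three properties, so that it is `N` by maximality. -/
theorem exists_closed_of_torsionPart_eq_bot [(torsion 𝒜 ι).IsSerreClass]
    (hM : M.torsionPart = ⊥) :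
    ∃ (H : GrMod 𝒜 ι) (η : M ⟶ H),
      closedObjects (torsion 𝒜 ι) H ∧ (torsion 𝒜 ι).isoModSerre η := by
  let E := Injective.under M
  let i : M ⟶ E := Injective.ι M
  have hi : Function.Injective i.1 := (mono_iff_injective i).1 inferInstance
  let 𝒮 : Set (Submodule Aᵐᵒᵖ E.carrier) :=
    {N | E.IsHomog N ∧ N ≤ sat 𝒜 (LinearMap.range i.1) ∧ ∀ x ∈ N, x ∈ E.torsionPart → x = 0}
  have hi𝒮 : LinearMap.range i.1 ∈ 𝒮 := by
    refine ⟨isHomog_range i, le_sat 𝒜 _, ?_⟩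
    rintro _ ⟨x, rfl⟩ hx
    have h := mem_torsionPart_of_map i hi hx
    rw [hM, Submodule.mem_bot] at h
    rw [h, map_zero]
  obtain ⟨N, hiN, hN⟩ := zorn_le_nonempty₀ 𝒮 (fun c hc hchain y hy => by
    have hmem : ∀ x, x ∈ sSup c ↔ ∃ K ∈ c, x ∈ K := fun x =>
      Submodule.mem_sSup_of_directed ⟨y, hy⟩ hchain.directedOn
    refine ⟨sSup c, ⟨fun j x hx => ?_, fun x hx => ?_, fun x hx hxt => ?_⟩, fun _ => le_sSup⟩ <;>
    obtain ⟨K, hK, hxK⟩ := (hmem x).1 hx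
    · exact (hmem _).2 ⟨K, hK, (hc hK).1 j x hxK⟩
    · exact (hc hK).2.1 hxK
    · exact (hc hK).2.2 x hxK hxt) _ hi𝒮
  obtain ⟨hNhom, hNsat, hNtf⟩ := hN.prop
  have hιinj : Function.Injective (subι N hNhom).1 := Subtype.val_injective
  have htf : (sub N hNhom).torsionPart = ⊥ := eq_bot_iff.2 fun x hx =>
    Subtype.ext (hNtf _ x.2 (map_mem_torsionPart (subι N hNhom) hx))
  have hcl : closedObjects (torsion 𝒜 ι) (sub N hNhom) := by
    refine ⟨fun Y hY f => hom_ext fun y => ?_, fun X Y f g h hS hY => ?_⟩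
    · have := map_mem_torsionPart f (torsionPart_eq_top hY y)
      rwa [htf] at this
    have hf : Function.Injective f.1 := (mono_iff_injective f).1 hS.mono_f
    have hsat : ∀ x, x ∈ sat 𝒜 (LinearMap.range f.1) := fun x => by
      have hg := (mem_sat_ker_iff g.1).2 ((torsion_iff Y).1 hY (g.1 x))
      rwa [(function_exact hS.exact).linearMap_ker_eq] at hg
    -- `N` embeds into `X` modulo torsion, so that `N → E` extends to a morphism `k` on `X`.
    let π : X ⟶ quot _ (X.isHomog_homogCore (sat 𝒜 ⊥)) := quotπ _ _
    have hπ : ∀ x, π.1 x = 0 ↔ x ∈ X.torsionPart := fun x => Submodule.Quotient.mk_eq_zero _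
    have : Mono (f ≫ π) := by
      rw [mono_iff_injective, injective_iff_map_eq_zero]
      intro x hx
      have := mem_torsionPart_of_map f hf ((hπ _).1 hx)
      rwa [htf] at this
    let k : X ⟶ E := π ≫ Injective.factorThru (subι N hNhom) (f ≫ π)
    have hk : f ≫ k = subι N hNhom := by
      rw [← Injective.comp_factorThru (subι N hNhom) (f ≫ π), Category.assoc]
    have hk' : ∀ x, k.1 (f.1 x) = x.1 := congr_apply hk
    -- The torsion of the image of `k` comes from torsion of `X`, as `k` is injective on `N`.
    have hksat : ∀ z, k.1 z ∈ sat 𝒜 ⊥ → z ∈ sat 𝒜 ⊥ := by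
      intro z hz
      rw [← sat_sat hfg]
      obtain ⟨n, hn⟩ := hsat z
      refine ⟨n, fun a ha => ?_⟩
      obtain ⟨w, hw⟩ := hn a ha
      rw [← hw]
      refine map_mem_sat_bot _ ((map_mem_sat_bot_iff hιinj).1 ?_)
      change w.1 ∈ _
      rw [← hk', hw, map_smul]
      exact Submodule.smul_mem _ _ hz
    have hR : LinearMap.range k.1 ∈ 𝒮 := by
      refine ⟨isHomog_range k, ?_, ?_⟩
      · rintro _ ⟨x, rfl⟩
        rw [← sat_sat hfg]
        refine sat_mono 𝒜 hNsat ?_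
        change x ∈ (sat 𝒜 N).comap k.1
        rw [← sat_comap]
        refine sat_mono 𝒜 ?_ (hsat x)
        rintro _ ⟨w, rfl⟩
        change k.1 (f.1 w) ∈ N
        rw [hk']
        exact w.2
      · rintro _ ⟨x, rfl⟩ hx
        have hxt : x ∈ X.torsionPart := fun j => hksat _ (by rw [map_comp]; exact hx j)
        change (Injective.factorThru (subι N hNhom) (f ≫ π)).1 (π.1 x) = 0
        rw [(hπ x).2 hxt, map_zero]
    have hle : LinearMap.range k.1 ≤ N :=
      hN.le_of_ge hR fun x hx => ⟨f.1 ⟨x, hx⟩, hk' ⟨x, hx⟩⟩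
    exact ⟨ShortComplex.Splitting.ofExactOfRetraction _ hS.exact
      (subLift N hNhom k fun x => hle ⟨x, rfl⟩)
      (hom_ext fun x => Subtype.ext (hk' x)) hS.epi_g⟩
  refine ⟨sub N hNhom, subLift N hNhom i fun x => hiN ⟨x, rfl⟩, hcl, ?_⟩
  rw [isoModSerre_torsion_iff]
  refine ⟨fun x hx => ?_, fun y => ?_⟩
  · rw [hi ((congrArg Subtype.val hx).trans (map_zero i.1).symm)]
    exact zero_mem _
  · have hy : y ∈ (sat 𝒜 (LinearMap.range i.1)).comap N.subtype := hNsat y.2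
    rw [← sat_comap] at hy
    refine sat_mono 𝒜 ?_ hy
    rintro z ⟨x, hx⟩
    exact ⟨x, Subtype.ext hx⟩

/-- Every graded module maps to a closed one by an isomorphism modulo torsion. -/
theorem exists_closed [(torsion 𝒜 ι).IsSerreClass] (M : GrMod 𝒜 ι) :
    ∃ (H : GrMod 𝒜 ι) (η : M ⟶ H),
      closedObjects (torsion 𝒜 ι) H ∧ (torsion 𝒜 ι).isoModSerre η := by
  obtain ⟨H, η, hH, hη⟩ :=
    exists_closed_of_torsionPart_eq_bot hfg (torsionPart_quot_torsionPart hfg M)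
  refine ⟨H, quotπ _ _ ≫ η, hH, (torsion 𝒜 ι).isoModSerre.comp_mem _ _ ?_ hη⟩
  rw [isoModSerre_torsion_iff]
  refine ⟨fun x hx => M.homogCore_le _ ((Submodule.Quotient.mk_eq_zero _).1 hx), fun y => ?_⟩
  exact le_sat 𝒜 _ (Submodule.mkQ_surjective _ y)

end GrMod

end Torsion

/-! ### Extension by zero and truncation -/

section Truncation

variable {A : Type u} [Ring A] {𝒜 : ℕ → AddSubgroup A} [GradedRing 𝒜]

/-- `(A₊)ⁿ` lies in degrees `≥ n`. -/
theorem irr_pow_le_iSup (n : ℕ) {a : A} (ha : a ∈ irr 𝒜 ^ n) : a ∈ ⨆ i, 𝒜 (n + i) := by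
  classical
  induction n generalizing a with
  | zero =>
    simp only [zero_add]
    rw [← DirectSum.sum_support_decompose 𝒜 a]
    exact sum_mem fun i _ => AddSubgroup.mem_iSup_of_mem i (SetLike.coe_mem _)
  | succ n ih =>
    rw [Submodule.pow_succ] at ha
    induction ha using Submodule.mul_induction_on' with
    | mem_mul_mem b hb c hc =>
      rw [← DirectSum.sum_support_decompose 𝒜 c, Finset.mul_sum]
      refine sum_mem fun k _ => ?_
      rcases k with _ | k
      · have h0 : (DirectSum.decompose 𝒜 c 0 : A) = 0 := hc
        rw [h0, mul_zero]
        exact zero_mem _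
      · have hle : (⨆ i, 𝒜 (n + i)) ≤ (⨆ i, 𝒜 (n + 1 + i)).comap
            (AddMonoidHom.mulRight (DirectSum.decompose 𝒜 c (k + 1) : A)) := by
          refine iSup_le fun i x hx => AddSubgroup.mem_iSup_of_mem (i + k) ?_
          have := SetLike.mul_mem_graded hx (SetLike.coe_mem (DirectSum.decompose 𝒜 c (k + 1)))
          rwa [show n + i + (k + 1) = n + 1 + (i + k) by omega] at this
        exact hle (ih hb)
    | add x _ y _ hx hy => exact add_mem hx hy

/-- The quotient `M / M_{≥ 0}` is torsion. -/
theorem mem_sat_tail (M : GrZ 𝒜) (x : M.carrier) : x ∈ sat 𝒜 M.tail := by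
  induction x using M.induction with
  | zero => exact zero_mem _
  | homogeneous j y hy =>
    -- An element of degree `j < 0` is moved into degrees `≥ 0` by `(A₊)^(-j)`.
    refine ⟨(-j).toNat, fun a ha => ?_⟩
    have hle : (⨆ i, 𝒜 ((-j).toNat + i)) ≤ M.tail.toAddSubgroup.comap
        (AddMonoidHom.mk' (fun a : A => MulOpposite.op a • y)
          (fun a b => by rw [← add_smul]; rfl)) := by
      refine iSup_le fun i a ha => AddSubgroup.mem_iSup_of_mem (j + ((-j).toNat + i)).toNat ?_
      have h := M.smul_mem hy ha
      rw [Int.toNat_of_nonneg (by omega)]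
      exact_mod_cast h
    exact hle (irr_pow_le_iSup _ ha)
  | add y z hy hz => exact add_mem hy hz

theorem comp_negSucc_of_mem_tail (M : GrZ 𝒜) {x : M.carrier} (hx : x ∈ M.tail) (n : ℕ) :
    M.comp (Int.negSucc n) x = 0 := by
  have hle : (⨆ m : ℕ, M.deg (m : ℤ)) ≤ (M.comp (Int.negSucc n)).ker :=
    iSup_le fun m y hy => M.comp_of_mem_ne hy (by omega)
  exact hle hx

/-- An element of the tail that has a preimage has a preimage in the tail. -/
theorem exists_mem_tail_map_eq {M N : GrZ 𝒜} (f : M ⟶ N) (x : M.carrier)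
    (hx : f.1 x ∈ N.tail) : ∃ z ∈ M.tail, f.1 z = f.1 x := by
  classical
  refine ⟨∑ j ∈ (DirectSum.decompose M.deg x).support with 0 ≤ j, M.comp j x,
    sum_mem fun j hj => ?_, ?_⟩
  · obtain ⟨n, rfl⟩ := Int.eq_ofNat_of_zero_le (Finset.mem_filter.1 hj).2
    exact AddSubgroup.mem_iSup_of_mem n (M.comp_mem _ x)
  · conv_rhs => rw [← M.sum_comp x]
    rw [map_sum, map_sum, Finset.sum_filter]
    refine Finset.sum_congr rfl fun j _ => ?_
    split_ifs with h
    · rfl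
    · obtain ⟨n, rfl⟩ := Int.eq_negSucc_of_lt_zero (not_le.1 h)
      rw [GrMod.map_comp, comp_negSucc_of_mem_tail N hx]

section Serre

variable [(torsion 𝒜 ℕ).IsSerreClass] [(torsion 𝒜 ℤ).IsSerreClass]

/-- Both conditions only concern the underlying linear map, which extension by zero retains. -/
theorem isoModSerre_extend {M N : Gr 𝒜} {f : M ⟶ N} (hf : (torsion 𝒜 ℕ).isoModSerre f) :
    (torsion 𝒜 ℤ).isoModSerre ((extend 𝒜).map f) :=
  (isoModSerre_torsion_iff _).2 ((isoModSerre_torsion_iff f).1 hf)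

theorem isoModSerre_truncate {M N : GrZ 𝒜} {f : M ⟶ N} (hf : (torsion 𝒜 ℤ).isoModSerre f) :
    (torsion 𝒜 ℕ).isoModSerre ((truncate 𝒜).map f) := by
  rw [isoModSerre_torsion_iff] at hf ⊢
  refine ⟨fun x hx => ?_, fun y => ?_⟩
  · exact (map_mem_sat_bot_iff M.tail.injective_subtype).1 (hf.1 x.1 (congrArg Subtype.val hx))
  · obtain ⟨n, hn⟩ := hf.2 y.1
    refine ⟨n, fun a ha => ?_⟩
    obtain ⟨x, hx⟩ := hn a ha
    have hmem : f.1 x ∈ N.tail := hx ▸ N.tail.smul_mem _ y.2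
    obtain ⟨z, hz, hzx⟩ := exists_mem_tail_map_eq f x hmem
    exact ⟨⟨z, hz⟩, Subtype.ext (hzx.trans hx)⟩

end Serre

variable (𝒜)

/-- The identification `M = (i M)_{≥ 0}`. -/
def extendTruncateUnit : 𝟭 (Gr 𝒜) ⟶ extend 𝒜 ⋙ truncate 𝒜 where
  app M := ⟨LinearMap.id.codRestrict ((extend 𝒜).obj M).tail fun x =>
    mem_iSup_of_isInternal M.deg M.isInternal x, fun _ _ hm => hm⟩

instance : IsIso (extendTruncateUnit 𝒜) := by
  have (M : Gr 𝒜) : IsIso ((extendTruncateUnit 𝒜).app M) :=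
    GrMod.isIso_of_bijective _ ⟨fun _ _ h => congrArg Subtype.val h, fun y => ⟨y.1, rfl⟩⟩
  exact NatIso.isIso_of_isIso_app _

/-- The inclusion `M_{≥ 0} ⊆ M`. -/
def tailInclusion : truncate 𝒜 ⋙ extend 𝒜 ⟶ 𝟭 (GrZ 𝒜) where
  app M := ⟨M.tail.subtype, by
    rintro (n | n) m hm
    · exact hm
    · have h : M.tail.subtype m = 0 := congrArg Subtype.val (show m = 0 from hm)
      change M.tail.subtype m ∈ M.deg (Int.negSucc n)
      rw [h]
      exact zero_mem _⟩

theorem isoModSerre_tailInclusion [(torsion 𝒜 ℤ).IsSerreClass] (M : GrZ 𝒜) :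
    (torsion 𝒜 ℤ).isoModSerre ((tailInclusion 𝒜).app M) := by
  rw [isoModSerre_torsion_iff]
  refine ⟨fun x hx => ?_, fun y => ?_⟩
  · have : x = 0 := Subtype.ext hx
    rw [this]
    exact zero_mem _
  · have h : LinearMap.range ((tailInclusion 𝒜).app M).1 = M.tail := M.tail.range_subtype
    rw [h]
    exact mem_sat_tail M y

end Truncation

/-! ### The equivalence -/

section Equivalence

variable {A : Type u} [Ring A] (𝒜 : ℕ → AddSubgroup A) [GradedRing 𝒜]
  (hfg : (irrelevantRight 𝒜).FG) {q : Gr 𝒜 ⥤ QGr 𝒜} {Q : GrZ 𝒜 ⥤ QGrZ 𝒜}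
  (adj : q ⊣ inclQGr 𝒜) (adjZ : Q ⊣ inclQGrZ 𝒜)

include hfg

/-- The equivalence between `QGr A` and `QGr^ℤ A`. The reflectors invert the morphisms with torsion
kernel and cokernel, hence the (truncated or extended) units of the two adjunctions and the
inclusions `M_{≥ 0} ⊆ M`. -/
noncomputable def qgrEquivalence : QGr 𝒜 ≌ QGrZ 𝒜 :=
  have := isSerreClass_torsion (ι := ℕ) hfg
  have := isSerreClass_torsion (ι := ℤ) hfg
  have (M : GrZ 𝒜) : IsIso (q.map ((truncate 𝒜).map (adjZ.unit.app M))) :=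
    isoModSerre_isInvertedBy adj _
      (isoModSerre_truncate (isoModSerre_unit adjZ (GrMod.exists_closed hfg) M))
  have (M : Gr 𝒜) : IsIso (Q.map ((extend 𝒜).map (adj.unit.app M))) :=
    isoModSerre_isInvertedBy adjZ _
      (isoModSerre_extend (isoModSerre_unit adj (GrMod.exists_closed hfg) M))
  have (M : GrZ 𝒜) : IsIso (Q.map ((tailInclusion 𝒜).app M)) :=
    isoModSerre_isInvertedBy adjZ _ (isoModSerre_tailInclusion 𝒜 M)
  have : IsIso (Functor.whiskerRight adjZ.unit (truncate 𝒜 ⋙ q)) := by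
    rw [NatTrans.isIso_iff_isIso_app]
    assumption
  have : IsIso (Functor.whiskerRight adj.unit (extend 𝒜 ⋙ Q)) := by
    rw [NatTrans.isIso_iff_isIso_app]
    assumption
  have : IsIso (Functor.whiskerRight (tailInclusion 𝒜) Q) := by
    rw [NatTrans.isIso_iff_isIso_app]
    assumption
  CategoryTheory.Equivalence.mk (inclQGr 𝒜 ⋙ extend 𝒜 ⋙ Q) (inclQGrZ 𝒜 ⋙ truncate 𝒜 ⋙ q)
    ((asIso adj.counit).symm ≪≫
      Functor.isoWhiskerLeft (inclQGr 𝒜)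
        (Functor.isoWhiskerRight (asIso (extendTruncateUnit 𝒜)) q ≪≫
          Functor.isoWhiskerLeft (extend 𝒜)
            (asIso (Functor.whiskerRight adjZ.unit (truncate 𝒜 ⋙ q)))))
    (Functor.isoWhiskerLeft (inclQGrZ 𝒜)
        (Functor.isoWhiskerLeft (truncate 𝒜)
            (asIso (Functor.whiskerRight adj.unit (extend 𝒜 ⋙ Q))).symm ≪≫
          asIso (Functor.whiskerRight (tailInclusion 𝒜) Q)) ≪≫
      asIso adjZ.counit)

end Equivalence

end QuasiCoh

theorem mainTheorem5 {A : Type u} [Ring A] (𝒜 : ℕ → AddSubgroup A) [GradedRing 𝒜]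
    (hfg : (QuasiCoh.irrelevantRight 𝒜).FG) :
    (QuasiCoh.IsGrothendieckCategory (QuasiCoh.QGr 𝒜) ∧
      QuasiCoh.IsGrothendieckCategory (QuasiCoh.QGrZ 𝒜)) ∧
    ((QuasiCoh.inclQGr 𝒜).IsRightAdjoint ∧ (QuasiCoh.inclQGrZ 𝒜).IsRightAdjoint) ∧
    ∀ (q : QuasiCoh.Gr 𝒜 ⥤ QuasiCoh.QGr 𝒜) (Q : QuasiCoh.GrZ 𝒜 ⥤ QuasiCoh.QGrZ 𝒜),
      Nonempty (q ⊣ QuasiCoh.inclQGr 𝒜) → Nonempty (Q ⊣ QuasiCoh.inclQGrZ 𝒜) →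
      ((PreservesFiniteLimits q ∧ PreservesFiniteColimits q) ∧
        (PreservesFiniteLimits Q ∧ PreservesFiniteColimits Q)) ∧
      ∃ e : QuasiCoh.QGr 𝒜 ≌ QuasiCoh.QGrZ 𝒜,
        e.functor = QuasiCoh.inclQGr 𝒜 ⋙ QuasiCoh.extend 𝒜 ⋙ Q ∧
        e.inverse = QuasiCoh.inclQGrZ 𝒜 ⋙ QuasiCoh.truncate 𝒜 ⋙ q := by
  have := QuasiCoh.isSerreClass_torsion (ι := ℕ) hfg
  have := QuasiCoh.isSerreClass_torsion (ι := ℤ) hfg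
  have h := QuasiCoh.GrMod.exists_closed (ι := ℕ) hfg
  have hZ := QuasiCoh.GrMod.exists_closed (ι := ℤ) hfg
  have hadj : (QuasiCoh.inclQGr 𝒜).IsRightAdjoint := QuasiCoh.isRightAdjoint_quotientInclusion h
  have hadjZ : (QuasiCoh.inclQGrZ 𝒜).IsRightAdjoint := QuasiCoh.isRightAdjoint_quotientInclusion hZ
  refine ⟨⟨?_, ?_⟩, ⟨hadj, hadjZ⟩, ?_⟩
  · exact QuasiCoh.isGrothendieckCategory_quotient (Adjunction.ofIsRightAdjoint _) h
  · exact QuasiCoh.isGrothendieckCategory_quotient (Adjunction.ofIsRightAdjoint _) hZ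
  · rintro q Q ⟨adj⟩ ⟨adjZ⟩
    exact ⟨⟨QuasiCoh.preservesFiniteLimits_and_colimits adj h,
      QuasiCoh.preservesFiniteLimits_and_colimits adjZ hZ⟩,
      QuasiCoh.qgrEquivalence 𝒜 hfg adj adjZ, rfl, rfl⟩
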